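/- **Setting.** First-order rational Pavelka logic $\mathrm{RPL}\forall$ is used with $0$ as the highest and $1$ as the lowest degree of truth: $\varphi\to\psi$ has value $\max\{\psi-\varphi,0\}$, $\forall$ is the supremum, and there is a truth constant $\bar r$ for each rational $r\in[0,1]$ (with $\bot=\bar 1$). Provability $\vdash$ is by the usual axioms of Łukasiewicz logic, the two quantifier axioms, the bookkeeping axioms $(\bar r\to\bar s)\leftrightarrow\overline{\max\{s-r,0\}}$, and reflexivity, symmetry and transitivity of the similarity relation $\approx$, with modus ponens and generalization. Let $L$ be a computably given countable metric signature: its sets of function and relation symbols are decidable, its arities are computable, and every symbol $s$ and argument place $i$ carries a modulus $\delta_{s,i}:(0,1]\to(0,1]$. A structure consists of a set with functions, $[0,1]$-valued relations, and a $[0,1]$-valued pseudo-metric interpreting $\approx$. Let $UL$ be the set of uniform continuity axioms $(q\mathbin{\dot-}(x\approx y))\vee((R(\bar a,x,\bar b)\mathbin{\dot-}R(\bar a,y,\bar b))\mathbin{\dot-}r)$ and $(q\mathbin{\dot-}(x\approx y))\vee((f(\bar a,x,\bar b)\approx f(\bar a,y,\bar b))\mathbin{\dot-}r)$, for rationals $\epsilon,q,r\in[0,1]$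 with $\epsilon>0$, $r>\epsilon$, $q<\delta_{s,i}(\epsilon)$, where $s$ is the symbol and $x$ stands at place $i$; here $u\mathbin{\dot-}v$ has value $\max\{u-v,0\}$ and $\vee$ is the minimum. For a structure $M$ and a map $\nu:A\to M$ naming parameters, $\mathrm{Diag}_{el}(M,\nu)$ is the set of pairs $(\varphi,b)$ of a formula $\varphi$ of $L$ with constants from $A$ and an interval $b$ with rational end points in $[0,1]$ such that $b\ll\{\|\varphi\|_M\}$ in the domain of closed subintervals of $[0,1]$ under reverse inclusion ($\ll$ is the way-below relation, $\|\varphi\|_M$ is the supremum of the truth degrees over all evaluations). A structure $M$ is decidable over $\nu:\mathbb N\to M$ if $\nu$ has dense range and $\mathrm{Diag}_{el}(M,\nu)$ is computably enumerable; it is decidable if this holds for some $\nu$. **Theorem 3.12.** Let $T$ be a theory in $L$, and suppose that $T^*=T\cup UL$ is consistent, linear-complete (for all sentences $\varphi,\psi$, $T^*\vdash\varphi\to\psi$ or $T^*\vdash\psi\to\varphi$), computably axiomatizable and Henkin (if $T^*\vdash\exists x\,\varphi$ for a sentence $\exists x\,\varphi$, then $T^*\vdash\varphi[c/x]$ for some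 constant symbol $c$ of $L$). Let $B$ be a countable model of $T^*$ that is decidable over an enumeration $\nu:\mathbb N\to B$ of all its elements (for instance, the model whose elements are the constants of $L$ and whose truth degrees are the provability degrees). Let $M$ be the metric completion of the quotient of $B$ by the relation of being at distance $0$, and let $\iota:B\to M$ be the canonical map. Then $M$ carries an $L$-structure that interprets $\approx$ by the metric of $M$ (so it is a complete metric structure) such that: 1. $M\models T^*$; 2. $\iota$ commutes with the functions, and every formula with parameters from $B$ has the same truth degree in $B$ (under any evaluation) and in $M$ (under the evaluation composed with $\iota$, the parameters being read through $\iota$); that is, the image of $B$ is an elementary substructure of $M$; 3. $B$ and $M$ are elementarily equivalent: every sentence of $L$ has the same truth degree in both; 4. $\mathrm{Diag}_{el}(M,\iota)=\mathrm{Diag}_{el}(B,\mathrm{id}_B)$; 5. $M$ is decidable, namely over the dense sequence $\iota\circ\nu$. -/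

import Mathlib

/-! First-order rational Pavelka logic over a metric signature. As usual in continuous logic, `0` is
the highest degree of truth and `1` the least one. -/

namespace RPL

universe u v

/-- A (countable) metric continuous signature: function and relation symbols (coded by natural
numbers) with arities, and for every symbol and every argument place a modulus of continuity
`δ : (0,1] → (0,1]`. The distinguished binary relation `≈` is a separate atomic formula below.
Constants are the function symbols of arity `0`. -/
structure Signature where
  Fn : Set ℕ
  Rel : Set ℕ
  fnArity : Fn → ℕ
  relArity : Rel → ℕ
  fnMod : (f : Fn) → Fin (fnArity f) → Set.Ioc (0 : ℝ) 1 → Set.Ioc (0 : ℝ) 1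
  relMod : (R : Rel) → Fin (relArity R) → Set.Ioc (0 : ℝ) 1 → Set.Ioc (0 : ℝ) 1

/-- The sets of symbols are decidable and the arities are computable. -/
structure Signature.ComputablyGiven (L : Signature) : Prop where
  fn_decidable : ComputablePred (fun n => n ∈ L.Fn)
  rel_decidable : ComputablePred (fun n => n ∈ L.Rel)
  fnArity_computable : ∃ g : ℕ → ℕ, Computable g ∧ ∀ f : L.Fn, g f = L.fnArity f
  relArity_computable : ∃ g : ℕ → ℕ, Computable g ∧ ∀ R : L.Rel, g R = L.relArity R

/-- Rationals in `[0,1]`. -/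
abbrev RatUnit : Type := Set.Icc (0 : ℚ) 1

/-- Truncated subtraction `s ∸ r` on the rationals of `[0,1]`. -/
def RatUnit.tsub (s r : RatUnit) : RatUnit :=
  ⟨max (s.1 - r.1) 0, le_max_right _ _, max_le (by linarith [s.2.2, r.2.1]) zero_le_one⟩

/-- Truncated subtraction `y ∸ x` on `[0,1]`. -/
noncomputable def tsub (y x : unitInterval) : unitInterval :=
  ⟨max ((y : ℝ) - x) 0, le_max_right _ _, max_le (by linarith [y.2.2, x.2.1]) zero_le_one⟩

/-- The real truth value of a rational truth constant. -/
noncomputable def RatUnit.toUnit (q : RatUnit) : unitInterval :=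
  ⟨(q.1 : ℝ), by exact_mod_cast q.2.1, by exact_mod_cast q.2.2⟩

/-! ### Syntax -/

/-- Terms of `L_A`: the language `L` with a new constant for every element of `A`. -/
inductive Term (L : Signature) (A : Type u) : Type u
  | var (n : ℕ) : Term L A
  | param (a : A) : Term L A
  | app (f : L.Fn) (ts : Fin (L.fnArity f) → Term L A) : Term L A

/-- Formulas of `L_A`, with primitive connectives `→`, `∀` and the truth constants. -/
inductive Formula (L : Signature) (A : Type u) : Type u
  | rel (R : L.Rel) (ts : Fin (L.relArity R) → Term L A) : Formula L A
  | sim (t s : Term L A) : Formula L A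
  | const (r : RatUnit) : Formula L A
  | imp (φ ψ : Formula L A) : Formula L A
  | all (x : ℕ) (φ : Formula L A) : Formula L A

/-- Formulas of `L` itself. -/
abbrev LFormula (L : Signature) : Type := Formula L Empty

section Calculus

variable {L : Signature} {A : Type u}

/-- The constant symbol `c`, as a term. -/
def Term.ofConstant (c : L.Fn) (hc : L.fnArity c = 0) : Term L A :=
  .app c (fun i => (Fin.cast hc i).elim0)

/-- The variable `x` occurs in the term. -/
def Term.Occurs (x : ℕ) : Term L A → Prop
  | .var y => x = y
  | .param _ => False
  | .app _ ts => ∃ i, (ts i).Occurs x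

/-- `s[t/x]`, written `s.subst x t`. -/
def Term.subst : Term L A → ℕ → Term L A → Term L A
  | .var y, x, t => if y = x then t else .var y
  | .param a, _, _ => .param a
  | .app f ts, x, t => .app f (fun i => (ts i).subst x t)

namespace Formula

/-- Falsity, the truth constant of value `1`. -/
def bot : Formula L A := .const ⟨1, zero_le_one, le_rfl⟩

def neg (φ : Formula L A) : Formula L A := φ.imp bot

/-- Strong conjunction `φ ⊕ ψ`, of value `min (φ + ψ) 1`. -/
def oplus (φ ψ : Formula L A) : Formula L A := (φ.imp ψ.neg).neg

/-- Weak disjunction `φ ∨ ψ`, of value `min φ ψ`. -/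
def or (φ ψ : Formula L A) : Formula L A := (φ.imp ψ).imp ψ

def iff (φ ψ : Formula L A) : Formula L A := (φ.imp ψ).oplus (ψ.imp φ)

def ex (x : ℕ) (φ : Formula L A) : Formula L A := (Formula.all x φ.neg).neg

/-- `φ ∸ ψ`, that is `ψ → φ`. -/
def minus (φ ψ : Formula L A) : Formula L A := ψ.imp φ

/-- The variable `x` is free in the formula. -/
def Free (x : ℕ) : Formula L A → Prop
  | .rel _ ts => ∃ i, (ts i).Occurs x
  | .sim t s => t.Occurs x ∨ s.Occurs x
  | .const _ => False
  | .imp φ ψ => φ.Free x ∨ ψ.Free x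
  | .all y φ => x ≠ y ∧ φ.Free x

def IsSentence (φ : Formula L A) : Prop := ∀ x, ¬ φ.Free x

/-- `φ[t/x]`, written `φ.subst x t`: the free occurrences of `x` are replaced by `t`. -/
def subst : Formula L A → ℕ → Term L A → Formula L A
  | .rel R ts, x, t => .rel R (fun i => (ts i).subst x t)
  | .sim s₁ s₂, x, t => .sim (s₁.subst x t) (s₂.subst x t)
  | .const r, _, _ => .const r
  | .imp φ ψ, x, t => .imp (φ.subst x t) (ψ.subst x t)
  | .all y φ, x, t => if y = x then .all y φ else .all y (φ.subst x t)

/-- No variable of `t` becomes bound when `t` is substituted for `x` in the formula. -/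
def Substitutable (x : ℕ) (t : Term L A) : Formula L A → Prop
  | .rel _ _ => True
  | .sim _ _ => True
  | .const _ => True
  | .imp φ ψ => φ.Substitutable x t ∧ ψ.Substitutable x t
  | .all y φ => ¬ (Formula.all y φ).Free x ∨ (¬ t.Occurs y ∧ φ.Substitutable x t)

end Formula

/-! ### The deduction system -/

/-- The logical axioms: Łukasiewicz logic, quantifiers, bookkeeping for the truth constants, and
similarity (reflexivity, symmetry, transitivity). Congruence is not included. -/
inductive LogicalAx : Formula L A → Prop
  | l1 (φ ψ : Formula L A) : LogicalAx (φ.imp (ψ.imp φ))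
  | l2 (φ ψ σ : Formula L A) : LogicalAx ((φ.imp ψ).imp ((ψ.imp σ).imp (φ.imp σ)))
  | l3 (φ ψ : Formula L A) : LogicalAx (((φ.imp ψ).imp ψ).imp ((ψ.imp φ).imp φ))
  | l4 (φ ψ : Formula L A) :
      LogicalAx (((φ.imp Formula.bot).imp (ψ.imp Formula.bot)).imp (ψ.imp φ))
  | all1 (x : ℕ) (t : Term L A) (φ : Formula L A) (h : φ.Substitutable x t) :
      LogicalAx ((Formula.all x φ).imp (φ.subst x t))
  | all2 (x : ℕ) (φ ψ : Formula L A) (h : ¬ φ.Free x) :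
      LogicalAx ((Formula.all x (φ.imp ψ)).imp (φ.imp (Formula.all x ψ)))
  | book (r s : RatUnit) :
      LogicalAx (((Formula.const r).imp (Formula.const s)).iff (Formula.const (s.tsub r)))
  | simRefl (x : ℕ) : LogicalAx (.sim (.var x) (.var x))
  | simSymm (x y : ℕ) :
      LogicalAx (Formula.imp (.sim (.var x) (.var y)) (.sim (.var y) (.var x)))
  | simTrans (x y z : ℕ) :
      LogicalAx (Formula.imp
        (Formula.oplus (.sim (.var x) (.var y)) (.sim (.var y) (.var z)))
        (.sim (.var x) (.var z)))

/-- `T ⊢ φ`, by modus ponens and generalization. -/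
inductive Provable (T : Set (Formula L A)) : Formula L A → Prop
  | logical {φ : Formula L A} (h : LogicalAx φ) : Provable T φ
  | hyp {φ : Formula L A} (h : φ ∈ T) : Provable T φ
  | mp {φ ψ : Formula L A} (h₁ : Provable T φ) (h₂ : Provable T (φ.imp ψ)) : Provable T ψ
  | gen (x : ℕ) {φ : Formula L A} (h : Provable T φ) : Provable T (Formula.all x φ)

def Consistent (T : Set (Formula L A)) : Prop := ¬ Provable T Formula.bot

def LinearComplete (T : Set (Formula L A)) : Prop :=
  ∀ φ ψ : Formula L A, φ.IsSentence → ψ.IsSentence →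
    Provable T (φ.imp ψ) ∨ Provable T (ψ.imp φ)

/-- If `T` proves a sentence `∃ x φ`, then it proves `φ[c/x]` for some constant symbol `c`. -/
def Henkin (T : Set (Formula L A)) : Prop :=
  ∀ (x : ℕ) (φ : Formula L A), (Formula.ex x φ).IsSentence → Provable T (Formula.ex x φ) →
    ∃ (c : L.Fn) (hc : L.fnArity c = 0), Provable T (φ.subst x (Term.ofConstant c hc))

end Calculus

/-! ### Uniform continuity axioms -/

/-- The uniform continuity axioms `UL` of the signature: for all rational `ε, q, r ∈ [0,1]` with
`ε > 0`, `r > ε` and `q < δ ε`, where `δ` is the modulus of the symbol at its `i`-th place,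
`(q ∸ (x ≈ y)) ∨ ((R(a,x,b) ∸ R(a,y,b)) ∸ r)`, and
`(q ∸ (x ≈ y)) ∨ ((f(a,x,b) ≈ f(a,y,b)) ∸ r)`. The arguments are the variables `0, …, n - 1`, where
`n` is the arity; `x` is the variable `i`, and `y` is the variable `n`. -/
inductive UL (L : Signature) : LFormula L → Prop
  | rel (R : L.Rel) (i : Fin (L.relArity R)) (ε q r : RatUnit)
      (hε : (ε.1 : ℝ) ∈ Set.Ioc (0 : ℝ) 1) (hr : ε < r)
      (hq : (q.1 : ℝ) < (L.relMod R i ⟨(ε.1 : ℝ), hε⟩ : ℝ)) :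
      UL L (Formula.or
        ((Formula.const q).minus (.sim (.var i) (.var (L.relArity R))))
        (Formula.minus
          ((Formula.rel R (fun j => .var j)).minus
            (Formula.rel R (Function.update (fun j => .var j) i (.var (L.relArity R)))))
          (.const r)))
  | fn (f : L.Fn) (i : Fin (L.fnArity f)) (ε q r : RatUnit)
      (hε : (ε.1 : ℝ) ∈ Set.Ioc (0 : ℝ) 1) (hr : ε < r)
      (hq : (q.1 : ℝ) < (L.fnMod f i ⟨(ε.1 : ℝ), hε⟩ : ℝ)) :
      UL L (Formula.or
        ((Formula.const q).minus (.sim (.var i) (.var (L.fnArity f))))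
        (Formula.minus
          (.sim (.app f (fun j => .var j))
            (.app f (Function.update (fun j => .var j) i (.var (L.fnArity f)))))
          (.const r)))

/-- The theory in rational Pavelka logic that corresponds to the theory `T` of continuous logic:
`T` together with the uniform continuity axioms of the signature. -/
def withUL {L : Signature} (T : Set (LFormula L)) : Set (LFormula L) := T ∪ {φ | UL L φ}

/-! ### Semantics -/

/-- A standard structure: functions, `[0,1]`-valued relations, and a `[0,1]`-valued pseudo-metric
that interprets `≈`. (The moduli of continuity are imposed by the axioms `UL`.) -/
structure PreStructure (L : Signature) (M : Type u) where
  fn : (f : L.Fn) → (Fin (L.fnArity f) → M) → M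
  rel : (R : L.Rel) → (Fin (L.relArity R) → M) → unitInterval
  sim : M → M → unitInterval
  sim_self : ∀ x, sim x x = 0
  sim_comm : ∀ x y, sim x y = sim y x
  sim_triangle : ∀ x y z, (sim x z : ℝ) ≤ sim x y + sim y z

namespace PreStructure

variable {L : Signature} {M : Type u} {A : Type v}

/-- The pseudo-metric that interprets `≈`. -/
@[reducible] def pseudoMetricSpace (S : PreStructure L M) : PseudoMetricSpace M where
  dist x y := (S.sim x y : ℝ)
  dist_self x := by rw [S.sim_self]; rfl
  dist_comm x y := by rw [S.sim_comm]
  dist_triangle := S.sim_triangle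

/-- The value of a term, where the parameters are named by `ρ` and the variables evaluated by `e`. -/
def termVal (S : PreStructure L M) (ρ : A → M) (e : ℕ → M) : Term L A → M
  | .var n => e n
  | .param a => ρ a
  | .app f ts => S.fn f (fun i => S.termVal ρ e (ts i))

/-- The truth degree of a formula in `(M, e)`. -/
noncomputable def val (S : PreStructure L M) (ρ : A → M) : (ℕ → M) → Formula L A → unitInterval
  | e, .rel R ts => S.rel R (fun i => S.termVal ρ e (ts i))
  | e, .sim t s => S.sim (S.termVal ρ e t) (S.termVal ρ e s)
  | _, .const r => r.toUnit
  | e, .imp φ ψ => tsub (S.val ρ e ψ) (S.val ρ e φ)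
  | e, .all x φ => ⨆ a : M, S.val ρ (Function.update e x a) φ

/-- The truth degree `‖φ‖_M`: the supremum over all evaluations. -/
noncomputable def degree (S : PreStructure L M) (ρ : A → M) (φ : Formula L A) : unitInterval :=
  ⨆ e : ℕ → M, S.val ρ e φ

/-- `M ⊨ T`: every formula of `T` has truth degree `0` under every evaluation. -/
def Models (S : PreStructure L M) (T : Set (LFormula L)) : Prop :=
  ∀ φ ∈ T, ∀ e : ℕ → M, S.val Empty.elim e φ = 0

/-- The pseudo-metric is a metric. -/
def IsMetric (S : PreStructure L M) : Prop := ∀ x y, S.sim x y = 0 → x = y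

/-- The pseudo-metric is complete. -/
def IsComplete (S : PreStructure L M) : Prop :=
  @CompleteSpace M S.pseudoMetricSpace.toUniformSpace

variable {N : Type v}

/-- All sentences of the language have the same truth degree in the two structures. -/
def ElementarilyEquivalent (S : PreStructure L M) (S' : PreStructure L N) : Prop :=
  ∀ φ : LFormula L, φ.IsSentence → S.degree Empty.elim φ = S'.degree Empty.elim φ

/-- `j` commutes with the functions, and every formula of `L_M` keeps its truth degree: the image
of `j` is an elementary substructure. -/
def IsElementaryMap (S : PreStructure L M) (S' : PreStructure L N) (j : M → N) : Prop :=
  (∀ (f : L.Fn) (a : Fin (L.fnArity f) → M), j (S.fn f a) = S'.fn f (j ∘ a)) ∧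
    ∀ (φ : Formula L M) (e : ℕ → M), S'.val j (j ∘ e) φ = S.val id e φ

end PreStructure

/-! ### The interval domain and decidable structures -/

/-- `x` is way below `y`: if `y` is below the supremum of a directed set, then `x` is below one of
its members. -/
def WayBelow {P : Type*} [Preorder P] (x y : P) : Prop :=
  ∀ D : Set P, D.Nonempty → DirectedOn (· ≤ ·) D → ∀ s, IsLUB D s → y ≤ s → ∃ d ∈ D, x ≤ d

/-- The unit interval domain: the nonempty closed subintervals of `[0,1]` under reverse inclusion. -/
abbrev IntervalDomain : Type := (NonemptyInterval unitInterval)ᵒᵈ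

/-- The effective base of the unit interval domain: intervals with rational end points. -/
abbrev RatInterval : Type := NonemptyInterval RatUnit

noncomputable def RatInterval.toDomain (b : RatInterval) : IntervalDomain :=
  OrderDual.toDual ⟨(b.fst.toUnit, b.snd.toUnit), by
    have h : (b.fst : ℚ) ≤ b.snd := b.fst_le_snd
    exact Subtype.mk_le_mk.mpr (by exact_mod_cast h)⟩

/-- The embedding `x ↦ {x}` of `[0,1]` into its interval domain. -/
def pointInDomain (x : unitInterval) : IntervalDomain := OrderDual.toDual (NonemptyInterval.pure x)

/-! Gödel numbers. -/

def RatUnit.code (q : RatUnit) : ℕ := Nat.pair q.1.num.natAbs q.1.den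

def RatInterval.code (b : RatInterval) : ℕ := Nat.pair b.fst.code b.snd.code

section Coding

variable {L : Signature} {A : Type u}

/-- The Gödel number of a term, where the parameter `a` is coded by `c a`. -/
def Term.code (c : A → ℕ) : Term L A → ℕ
  | .var n => Nat.pair 0 n
  | .param a => Nat.pair 1 (c a)
  | .app f ts => Nat.pair 2 (Nat.pair f (Encodable.encode (List.ofFn fun i => (ts i).code c)))

/-- The Gödel number of a formula, where the parameter `a` is coded by `c a`. -/
def Formula.code (c : A → ℕ) : Formula L A → ℕ
  | .rel R ts => Nat.pair 0 (Nat.pair R (Encodable.encode (List.ofFn fun i => (ts i).code c)))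
  | .sim t s => Nat.pair 1 (Nat.pair (t.code c) (s.code c))
  | .const r => Nat.pair 2 r.code
  | .imp φ ψ => Nat.pair 3 (Nat.pair (φ.code c) (ψ.code c))
  | .all x φ => Nat.pair 4 (Nat.pair x (φ.code c))

end Coding

/-- The set of (Gödel numbers of) axioms of `T` is computably enumerable. -/
def ComputablyAxiomatizable {L : Signature} (T : Set (LFormula L)) : Prop :=
  REPred (fun n : ℕ => ∃ φ ∈ T, φ.code Empty.elim = n)

namespace PreStructure

variable {L : Signature} {M : Type u} {A : Type v}

/-- The elementary diagram with parameters from `A`, named in `M` by `ρ`: all pairs `(φ, b)` of a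
formula `φ` of `L_A` and a rational interval `b` that approximates the truth degree of `φ`. -/
def elemDiagram (S : PreStructure L M) (ρ : A → M) : Set (Formula L A × RatInterval) :=
  {p | WayBelow p.2.toDomain (pointInDomain (S.degree ρ p.1))}

/-- `S` is decidable over the countable set `X` enumerated by `ν`: `X` is dense, and the elementary
diagram of `S` with parameters from `X` (where `ν n` is named by `n`) is computably enumerable. -/
def DecidableOver (S : PreStructure L M) (ν : ℕ → M) : Prop :=
  @DenseRange M S.pseudoMetricSpace.toUniformSpace.toTopologicalSpace ℕ ν ∧
    REPred (fun n : ℕ => ∃ p ∈ S.elemDiagram ν, Nat.pair (p.1.code id) p.2.code = n)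

/-- A decidable structure. -/
def IsDecidable (S : PreStructure L M) : Prop := ∃ ν : ℕ → M, S.DecidableOver ν

/-- The underlying set of the metric completion of `S`: the completion of the metric quotient in
which points at distance `0` are identified. -/
def Completion (S : PreStructure L M) : Type u :=
  letI := S.pseudoMetricSpace
  UniformSpace.Completion (SeparationQuotient M)

noncomputable instance (S : PreStructure L M) : MetricSpace S.Completion :=
  letI := S.pseudoMetricSpace
  (inferInstance : MetricSpace (UniformSpace.Completion (SeparationQuotient M)))

/-- The canonical map of `S` into its metric completion. -/
def toCompletion (S : PreStructure L M) (x : M) : S.Completion :=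
  letI := S.pseudoMetricSpace
  ((SeparationQuotient.mk x : SeparationQuotient M) :
    UniformSpace.Completion (SeparationQuotient M))

end PreStructure

end RPL

/-! Every symbol of a model of `UL` is uniformly continuous for the pseudo-metric, so it extends to
the completion. In a uniformly continuous structure the truth degree of a formula is a uniformly
continuous function of the evaluation, for the product uniformity on `ℕ → M`: the quantifier step is
that the supremum of a uniformly equicontinuous family is uniformly continuous. As a continuous
function has the same supremum over a dense set as over the whole space, a dense substructure of a
uniformly continuous structure is elementary; everything else is read off from this. -/

namespace RPL

universe u v w

open Filter Function Uniformity

section UniformSpaces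

variable {ι X Y Z : Type*} [UniformSpace X] [UniformSpace Y] [UniformSpace Z]

theorem uniformContinuous_of_uniformEquicontinuous_update [Finite ι] [DecidableEq ι]
    {g : (ι → X) → Z}
    (hg : ∀ i, UniformEquicontinuous fun (a : ι → X) (x : X) => g (update a i x)) :
    UniformContinuous g := by
  cases nonempty_fintype ι
  suffices h : ∀ s : Finset ι, Tendsto
      (fun p : (ι → X) × (ι → X) => (g p.1, g (s.piecewise p.2 p.1))) (𝓤 _) (𝓤 Z) by
    simpa only [Finset.piecewise_univ, UniformContinuous] using h Finset.univ
  intro s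
  induction s using Finset.induction_on with
  | empty => simpa using tendsto_diag_uniformity (fun p : (ι → X) × (ι → X) => g p.1) _
  | insert j s hj ih =>
    refine ih.uniformity_trans fun U hU => mem_map.2 ?_
    have hproj : Tendsto (fun p : (ι → X) × (ι → X) => (p.1 j, p.2 j)) (𝓤 _) (𝓤 X) :=
      Pi.uniformContinuous_proj _ j
    filter_upwards [hproj.eventually (hg j U hU)] with p hp
    have hpj : s.piecewise p.2 p.1 j = p.1 j := Finset.piecewise_eq_of_notMem _ _ _ hj
    simpa [Finset.piecewise_insert, ← hpj] using hp (s.piecewise p.2 p.1)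

theorem uniformEquicontinuous_update [DecidableEq ι] (i : ι) :
    UniformEquicontinuous fun (x : X) (a : ι → X) => update a i x := by
  suffices h : Tendsto (fun q : ((ι → X) × (ι → X)) × X => (update q.1.1 i q.2, update q.1.2 i q.2))
      (𝓤 _ ×ˢ ⊤) (𝓤 (ι → X)) from
    fun U hU => (mem_prod_top.1 (h hU) :)
  nth_rw 2 [Pi.uniformity]
  refine tendsto_iInf.2 fun j => tendsto_comap_iff.2 ?_
  obtain rfl | hj := eq_or_ne j i
  · simpa [comp_def] using tendsto_diag_uniformity Prod.snd _
  · simpa [comp_def, hj] using Tendsto.comp (Pi.uniformContinuous_proj _ j) tendsto_fst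

theorem isUniformInducing_piMap {j : X → Y} (hj : IsUniformInducing j) :
    IsUniformInducing (Pi.map fun _ : ι => j) := by
  rw [isUniformInducing_iff, Pi.uniformity, Pi.uniformity, comap_iInf]
  simp_rw [← hj.comap_uniformity, comap_comap]
  rfl

theorem iSup_comp_of_denseRange {X : Type*} [TopologicalSpace X] {f : X → unitInterval}
    (hf : Continuous f) {j : ι → X} (hj : DenseRange j) : ⨆ i, f (j i) = ⨆ x, f x := by
  rw [← iSup_range' f j]
  exact hj.ciSup' hf

theorem coe_iSup_le_coe_iSup_add {f g : ι → unitInterval} {ε : ℝ} (hε : 0 ≤ ε)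
    (h : ∀ i, (f i : ℝ) ≤ g i + ε) :
    ((⨆ i, f i : unitInterval) : ℝ) ≤ (⨆ i, g i : unitInterval) + ε := by
  by_contra! hlt
  let c : unitInterval :=
    ⟨(⨆ i, g i : unitInterval) + ε, add_nonneg (⨆ i, g i).2.1 hε, hlt.le.trans (⨆ i, f i).2.2⟩
  obtain ⟨i, hi⟩ := lt_iSup_iff.1 (show c < ⨆ i, f i from hlt)
  have hgi : (g i : ℝ) ≤ (⨆ i, g i : unitInterval) := le_iSup g i
  have hci : (⨆ i, g i : unitInterval) + ε < (f i : ℝ) := hi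
  linarith [h i]

theorem uniformContinuous_iSup {f : ι → X → unitInterval} (hf : UniformEquicontinuous f) :
    UniformContinuous fun x => ⨆ i, f i x := by
  refine Metric.uniformity_basis_dist_le.tendsto_right_iff.2 fun ε hε => ?_
  filter_upwards [Metric.uniformEquicontinuous_iff_right.1 hf ε hε] with p hp
  have hle := fun i => abs_sub_le_iff.1 (hp i).le
  exact abs_sub_le_iff.2
    ⟨sub_le_iff_le_add'.2 (coe_iSup_le_coe_iSup_add hε.le fun i => by linarith [(hle i).1]),
      sub_le_iff_le_add'.2 (coe_iSup_le_coe_iSup_add hε.le fun i => by linarith [(hle i).2])⟩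

end UniformSpaces

section TruncatedSubtraction

theorem coe_tsub (y x : unitInterval) : (tsub y x : ℝ) = max ((y : ℝ) - x) 0 := rfl

theorem tsub_eq_zero_iff {y x : unitInterval} : tsub y x = 0 ↔ y ≤ x := by
  rw [← Subtype.coe_le_coe, ← sub_nonpos, ← max_eq_right_iff, ← coe_tsub, Subtype.ext_iff]
  rfl

theorem tsub_tsub_self (y x : unitInterval) : tsub y (tsub y x) = min y x := by
  have hx := x.2.1
  have hy := y.2.1
  rcases le_total y x with h | h
  · rw [min_eq_left h, tsub_eq_zero_iff.2 h]
    exact Subtype.ext (by simp [coe_tsub, hy])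
  · have h' : (x : ℝ) ≤ y := h
    rw [min_eq_right h]
    exact Subtype.ext (by simp [coe_tsub, h', hx])

theorem dist_le_of_tsub_le {y x : unitInterval} {ε : ℝ} (h₁ : (tsub y x : ℝ) ≤ ε)
    (h₂ : (tsub x y : ℝ) ≤ ε) : dist y x ≤ ε :=
  abs_sub_le_iff.2 ⟨(le_max_left _ _).trans h₁, (le_max_left _ _).trans h₂⟩

theorem uniformContinuous_tsub :
    UniformContinuous fun p : unitInterval × unitInterval => tsub p.1 p.2 :=
  CompactSpace.uniformContinuous_of_continuous (by unfold tsub; fun_prop)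

end TruncatedSubtraction

section RationalApproximation

theorem exists_ratUnit_btwn {x y : ℝ} (hx : 0 ≤ x) (hy : y ≤ 1) (h : x < y) :
    ∃ q : RatUnit, x < q.1 ∧ (q.1 : ℝ) < y := by
  obtain ⟨q, hxq, hqy⟩ := exists_rat_btwn h
  exact ⟨⟨q, by exact_mod_cast hx.trans hxq.le, by exact_mod_cast hqy.le.trans hy⟩, hxq, hqy⟩

theorem le_of_forall_ratUnit {u v : unitInterval} {δ : ℝ} {ε : RatUnit} (hδ : δ ≤ 1)
    (h : ∀ q r : RatUnit, (q.1 : ℝ) < δ → ε < r → q.toUnit ≤ u ∨ v ≤ r.toUnit)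
    (hu : (u : ℝ) < δ) : v ≤ ε.toUnit := by
  by_contra! hv
  obtain ⟨q, huq, hqδ⟩ := exists_ratUnit_btwn u.2.1 hδ hu
  obtain ⟨r, hεr, hrv⟩ := exists_ratUnit_btwn ε.toUnit.2.1 v.2.2 hv
  exact (h q r hqδ (Subtype.coe_lt_coe.1 (Rat.cast_lt.1 hεr))).elim (not_le.2 huq) (not_le.2 hrv)

end RationalApproximation

namespace PreStructure

variable {L : Signature} {M : Type u} {A : Type v}

section ContinuityAxioms

variable (S : PreStructure L M)

theorem val_or (ρ : A → M) (e : ℕ → M) (φ ψ : Formula L A) :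
    S.val ρ e (φ.or ψ) = min (S.val ρ e φ) (S.val ρ e ψ) := by
  rw [min_comm]
  exact tsub_tsub_self _ _

theorem val_minus_or_minus_eq_zero_iff (ρ : A → M) (e : ℕ → M) (φ ψ σ τ : Formula L A) :
    S.val ρ e ((φ.minus ψ).or (σ.minus τ)) = 0 ↔
      S.val ρ e φ ≤ S.val ρ e ψ ∨ S.val ρ e σ ≤ S.val ρ e τ := by
  rw [val_or, ← tsub_eq_zero_iff, ← tsub_eq_zero_iff]
  exact min_eq_bot

/-- The evaluation of the variables `0, …, n - 1` by `a` and of all other variables by `y`: the one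
at which the uniform continuity axioms are read. -/
def tupleEval {n : ℕ} (a : Fin n → M) (y : M) (k : ℕ) : M := if h : k < n then a ⟨k, h⟩ else y

@[simp] theorem tupleEval_coe {n : ℕ} (a : Fin n → M) (y : M) (i : Fin n) :
    tupleEval a y i = a i := by simp [tupleEval]

@[simp] theorem tupleEval_self {n : ℕ} (a : Fin n → M) (y : M) : tupleEval a y n = y := by
  simp [tupleEval]

theorem termVal_tupleEval_update (ρ : A → M) {n : ℕ} (a : Fin n → M) (y : M) (i j : Fin n) :
    S.termVal ρ (tupleEval a y) (update (fun k : Fin n => (Term.var k : Term L A)) i (.var n) j) =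
      update a i y j := by
  obtain rfl | h := eq_or_ne j i
  · simp [termVal]
  · simp [h, termVal]

variable {S}

theorem tsub_rel_update_le (hS : S.Models {φ | UL L φ}) (R : L.Rel) (i : Fin (L.relArity R))
    {ε : RatUnit} (hε : (ε.1 : ℝ) ∈ Set.Ioc (0 : ℝ) 1) {a : Fin (L.relArity R) → M} {y : M}
    (hy : (S.sim (a i) y : ℝ) < L.relMod R i ⟨_, hε⟩) :
    tsub (S.rel R a) (S.rel R (update a i y)) ≤ ε.toUnit := by
  refine le_of_forall_ratUnit (L.relMod R i ⟨_, hε⟩).2.2 (fun q r hq hr => ?_) hy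
  have h := (S.val_minus_or_minus_eq_zero_iff _ _ _ _ _ _).1
    (hS _ (UL.rel R i ε q r hε hr hq) (tupleEval a y))
  simpa only [Formula.minus, val, termVal_tupleEval_update, termVal, tupleEval_coe,
    tupleEval_self] using h

theorem sim_fn_update_le (hS : S.Models {φ | UL L φ}) (f : L.Fn) (i : Fin (L.fnArity f))
    {ε : RatUnit} (hε : (ε.1 : ℝ) ∈ Set.Ioc (0 : ℝ) 1) {a : Fin (L.fnArity f) → M} {y : M}
    (hy : (S.sim (a i) y : ℝ) < L.fnMod f i ⟨_, hε⟩) :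
    S.sim (S.fn f a) (S.fn f (update a i y)) ≤ ε.toUnit := by
  refine le_of_forall_ratUnit (L.fnMod f i ⟨_, hε⟩).2.2 (fun q r hq hr => ?_) hy
  have h := (S.val_minus_or_minus_eq_zero_iff _ _ _ _ _ _).1
    (hS _ (UL.fn f i ε q r hε hr hq) (tupleEval a y))
  simpa only [val, termVal_tupleEval_update, termVal, tupleEval_coe, tupleEval_self] using h

end ContinuityAxioms

section UniformContinuity

/-- The functions, the relations and `≈` are uniformly continuous. The uniformity is a parameter
because on a completion that of `pseudoMetricSpace` agrees only propositionally with the one of the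
metric space structure. -/
structure IsUniformlyContinuous [UniformSpace M] (S : PreStructure L M) : Prop where
  fn : ∀ f, UniformContinuous (S.fn f)
  rel : ∀ R, UniformContinuous (S.rel R)
  sim : UniformContinuous fun p : M × M => S.sim p.1 p.2

theorem Models.isUniformlyContinuous {S : PreStructure L M} (hS : S.Models {φ | UL L φ}) :
    letI := S.pseudoMetricSpace
    S.IsUniformlyContinuous := by
  let := S.pseudoMetricSpace
  refine ⟨fun f => ?_, fun R => ?_, uniformContinuous_dist.subtype_mk _⟩
  all_goals
    refine uniformContinuous_of_uniformEquicontinuous_update fun i =>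
      Metric.uniformEquicontinuous_iff.2 fun η hη => ?_
    obtain ⟨ε, hε₀, hεη⟩ := exists_ratUnit_btwn le_rfl (min_le_right η 1) (lt_min hη one_pos)
    have hε : (ε.1 : ℝ) ∈ Set.Ioc (0 : ℝ) 1 := ⟨hε₀, ε.toUnit.2.2⟩
  · refine ⟨L.fnMod f i ⟨_, hε⟩, (L.fnMod f i ⟨_, hε⟩).2.1, fun x y hxy a => ?_⟩
    have h := sim_fn_update_le hS f i hε (a := update a i x) (y := y) (by rwa [update_self])
    rw [update_idem] at h
    exact lt_of_le_of_lt h (hεη.trans_le (min_le_left _ _))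
  · refine ⟨L.relMod R i ⟨_, hε⟩, (L.relMod R i ⟨_, hε⟩).2.1, fun x y hxy a => ?_⟩
    have h : ∀ {x y}, dist x y < L.relMod R i ⟨_, hε⟩ →
        tsub (S.rel R (update a i x)) (S.rel R (update a i y)) ≤ ε.toUnit := fun {x y} hxy => by
      rw [← update_idem x y a]
      exact tsub_rel_update_le hS R i hε (by rwa [update_self])
    exact (dist_le_of_tsub_le (h hxy) (h (by rwa [dist_comm]))).trans_lt
      (hεη.trans_le (min_le_left _ _))

variable [UniformSpace M] {S : PreStructure L M}

theorem IsUniformlyContinuous.termVal (hS : S.IsUniformlyContinuous) (ρ : A → M) (t : Term L A) :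
    UniformContinuous fun e => S.termVal ρ e t := by
  induction t with
  | var n => exact Pi.uniformContinuous_proj _ n
  | param a => exact uniformContinuous_const
  | app f ts ih => exact (hS.fn f).comp (uniformContinuous_pi.2 ih)

theorem IsUniformlyContinuous.val (hS : S.IsUniformlyContinuous) (ρ : A → M) (φ : Formula L A) :
    UniformContinuous fun e => S.val ρ e φ := by
  induction φ with
  | rel R ts => exact (hS.rel R).comp (uniformContinuous_pi.2 fun i => hS.termVal ρ (ts i))
  | sim t s => exact hS.sim.comp ((hS.termVal ρ t).prodMk (hS.termVal ρ s))
  | const r => exact uniformContinuous_const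
  | imp φ ψ ihφ ihψ => exact uniformContinuous_tsub.comp (ihψ.prodMk ihφ)
  | all x φ ih =>
    exact uniformContinuous_iSup fun U hU => uniformEquicontinuous_update x _ (ih hU)

end UniformContinuity

section DenseSubstructure

variable {N : Type w} {S : PreStructure L M} {S' : PreStructure L N} {j : M → N}

/-- `j` preserves the functions, the relations and `≈`, so that its image is a substructure. It need
not be injective, as `≈` is only a pseudo-metric. -/
structure IsEmbedding (S : PreStructure L M) (S' : PreStructure L N) (j : M → N) : Prop where
  fn : ∀ f a, S'.fn f (j ∘ a) = j (S.fn f a)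
  rel : ∀ R a, S'.rel R (j ∘ a) = S.rel R a
  sim : ∀ x y, S'.sim (j x) (j y) = S.sim x y

theorem IsEmbedding.termVal (hj : S.IsEmbedding S' j) (ρ : A → M) (e : ℕ → M) (t : Term L A) :
    S'.termVal (j ∘ ρ) (j ∘ e) t = j (S.termVal ρ e t) := by
  induction t with
  | var n => rfl
  | param a => rfl
  | app f ts ih =>
    simp only [PreStructure.termVal, ih]
    exact hj.fn f _

variable [UniformSpace N]

theorem IsEmbedding.val (hj : S.IsEmbedding S' j) (hd : DenseRange j)
    (hS' : S'.IsUniformlyContinuous) (ρ : A → M) (e : ℕ → M) (φ : Formula L A) :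
    S'.val (j ∘ ρ) (j ∘ e) φ = S.val ρ e φ := by
  induction φ generalizing e with
  | rel R ts =>
    simp only [PreStructure.val, hj.termVal]
    exact hj.rel R _
  | sim t s => simp only [PreStructure.val, hj.termVal, hj.sim]
  | const r => rfl
  | imp φ ψ ihφ ihψ => simp only [PreStructure.val, ihφ, ihψ]
  | all x φ ih =>
    have hcont : Continuous fun a => S'.val (j ∘ ρ) (update (j ∘ e) x a) φ :=
      (hS'.val _ φ).continuous.comp (continuous_const.update x continuous_id)
    calc ⨆ a, S'.val (j ∘ ρ) (update (j ∘ e) x a) φ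
        = ⨆ m, S'.val (j ∘ ρ) (update (j ∘ e) x (j m)) φ := (iSup_comp_of_denseRange hcont hd).symm
      _ = ⨆ m, S.val ρ (update e x m) φ := by simp only [← comp_update, ih]

theorem IsEmbedding.isElementaryMap (hj : S.IsEmbedding S' j) (hd : DenseRange j)
    (hS' : S'.IsUniformlyContinuous) : S.IsElementaryMap S' j :=
  ⟨fun f a => (hj.fn f a).symm, fun φ e => hj.val hd hS' id e φ⟩

theorem IsEmbedding.degree (hj : S.IsEmbedding S' j) (hd : DenseRange j)
    (hS' : S'.IsUniformlyContinuous) (ρ : A → M) (φ : Formula L A) :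
    S'.degree (j ∘ ρ) φ = S.degree ρ φ :=
  calc ⨆ e, S'.val (j ∘ ρ) e φ
      = ⨆ e : ℕ → M, S'.val (j ∘ ρ) (j ∘ e) φ :=
        (iSup_comp_of_denseRange (hS'.val _ φ).continuous (DenseRange.piMap fun _ => hd)).symm
    _ = ⨆ e, S.val ρ e φ := by simp only [hj.val hd hS']

theorem IsEmbedding.degree_lFormula (hj : S.IsEmbedding S' j) (hd : DenseRange j)
    (hS' : S'.IsUniformlyContinuous) (φ : LFormula L) :
    S'.degree Empty.elim φ = S.degree Empty.elim φ := by
  rw [← hj.degree hd hS', Subsingleton.elim (j ∘ Empty.elim) Empty.elim]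

theorem IsEmbedding.elemDiagram (hj : S.IsEmbedding S' j) (hd : DenseRange j)
    (hS' : S'.IsUniformlyContinuous) (ρ : A → M) :
    S'.elemDiagram (j ∘ ρ) = S.elemDiagram ρ := by
  simp only [PreStructure.elemDiagram, hj.degree hd hS']

theorem models_iff_degree_eq_zero {T : Set (LFormula L)} :
    S.Models T ↔ ∀ φ ∈ T, S.degree Empty.elim φ = 0 :=
  forall₂_congr fun _ _ => iSup_eq_bot.symm

theorem IsEmbedding.models (hj : S.IsEmbedding S' j) (hd : DenseRange j)
    (hS' : S'.IsUniformlyContinuous) {T : Set (LFormula L)} (hT : S.Models T) : S'.Models T := by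
  simpa only [models_iff_degree_eq_zero, hj.degree_lFormula hd hS'] using hT

end DenseSubstructure

section MetricStructure

variable {N : Type w} [MetricSpace N] {S : PreStructure L N}

theorem pseudoMetricSpace_eq (hsim : ∀ x y, (S.sim x y : ℝ) = dist x y) :
    S.pseudoMetricSpace = ‹MetricSpace N›.toPseudoMetricSpace :=
  PseudoMetricSpace.ext (Dist.ext (funext₂ hsim))

theorem isMetric_of_sim_eq_dist (hsim : ∀ x y, (S.sim x y : ℝ) = dist x y) : S.IsMetric :=
  fun x y h => dist_eq_zero.1 ((hsim x y).symm.trans (congrArg Subtype.val h))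

theorem isComplete_of_sim_eq_dist [CompleteSpace N] (hsim : ∀ x y, (S.sim x y : ℝ) = dist x y) :
    S.IsComplete := by
  rw [IsComplete, pseudoMetricSpace_eq hsim]
  infer_instance

theorem decidableOver_iff_of_sim_eq_dist (hsim : ∀ x y, (S.sim x y : ℝ) = dist x y) {ν : ℕ → N} :
    S.DecidableOver ν ↔ DenseRange ν ∧
      REPred fun n : ℕ => ∃ p ∈ S.elemDiagram ν, Nat.pair (p.1.code id) p.2.code = n := by
  rw [DecidableOver, pseudoMetricSpace_eq hsim]

end MetricStructure

section Completion

variable (S : PreStructure L M)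

instance : CompleteSpace S.Completion :=
  letI := S.pseudoMetricSpace
  (inferInstance : CompleteSpace (UniformSpace.Completion (SeparationQuotient M)))

theorem dist_toCompletion (x y : M) :
    dist (S.toCompletion x) (S.toCompletion y) = S.sim x y := by
  let := S.pseudoMetricSpace
  exact (UniformSpace.Completion.dist_eq _ _).trans (SeparationQuotient.dist_mk x y)

theorem denseRange_toCompletion : DenseRange S.toCompletion := by
  let := S.pseudoMetricSpace
  exact UniformSpace.Completion.denseRange_coe.comp SeparationQuotient.surjective_mk.denseRange
    (UniformSpace.Completion.continuous_coe _)

theorem isUniformInducing_toCompletion :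
    letI := S.pseudoMetricSpace
    IsUniformInducing S.toCompletion := by
  let := S.pseudoMetricSpace
  exact (Isometry.of_dist_eq S.dist_toCompletion).isUniformInducing

theorem dist_completion_le_one (x y : S.Completion) : dist x y ≤ 1 := by
  refine S.denseRange_toCompletion.induction_on₂ (p := fun x y => dist x y ≤ 1)
    (isClosed_le continuous_dist continuous_const) (fun a b => ?_) x y
  rw [dist_toCompletion]
  exact (S.sim a b).2.2

theorem isDenseInducing_piMap_toCompletion (ι : Type*) :
    letI := S.pseudoMetricSpace
    IsDenseInducing (Pi.map fun _ : ι => S.toCompletion) := by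
  let := S.pseudoMetricSpace
  exact (isUniformInducing_piMap S.isUniformInducing_toCompletion).isDenseInducing
    (DenseRange.piMap fun _ => S.denseRange_toCompletion)

/-- The structure on the metric completion whose functions and relations are the extensions by
continuity of those of `S`. Where such an extension does not exist, `IsDenseInducing.extend` takes a
junk value; for uniformly continuous structures this does not happen. -/
noncomputable def completion : PreStructure L S.Completion where
  fn f :=
    letI := S.pseudoMetricSpace
    (S.isDenseInducing_piMap_toCompletion (Fin (L.fnArity f))).extend (S.toCompletion ∘ S.fn f)
  rel R :=
    letI := S.pseudoMetricSpace
    (S.isDenseInducing_piMap_toCompletion (Fin (L.relArity R))).extend (S.rel R)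
  sim x y := ⟨dist x y, dist_nonneg, S.dist_completion_le_one x y⟩
  sim_self x := Subtype.ext (dist_self x)
  sim_comm x y := Subtype.ext (dist_comm x y)
  sim_triangle := dist_triangle

variable {S}

theorem IsUniformlyContinuous.completion
    (hS : letI := S.pseudoMetricSpace; S.IsUniformlyContinuous) :
    S.completion.IsUniformlyContinuous := by
  let := S.pseudoMetricSpace
  have hι {ι : Type} := isUniformInducing_piMap (ι := ι) S.isUniformInducing_toCompletion
  have hd {ι : Type} := (S.isDenseInducing_piMap_toCompletion ι).dense
  have hj := S.isUniformInducing_toCompletion.uniformContinuous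
  exact ⟨fun f => uniformContinuous_uniformly_extend hι hd (hj.comp (hS.fn f)),
    fun R => uniformContinuous_uniformly_extend hι hd (hS.rel R),
    uniformContinuous_dist.subtype_mk _⟩

theorem IsUniformlyContinuous.isEmbedding_toCompletion
    (hS : letI := S.pseudoMetricSpace; S.IsUniformlyContinuous) :
    S.IsEmbedding S.completion S.toCompletion := by
  let := S.pseudoMetricSpace
  have hd {ι : Type} := S.isDenseInducing_piMap_toCompletion ι
  have hj := S.isUniformInducing_toCompletion.uniformContinuous
  exact ⟨fun f a => hd.extend_eq (hj.comp (hS.fn f)).continuous a,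
    fun R a => hd.extend_eq (hS.rel R).continuous a,
    fun x y => Subtype.ext (S.dist_toCompletion x y)⟩

theorem DecidableOver.completion (hS : letI := S.pseudoMetricSpace; S.IsUniformlyContinuous)
    {ν : ℕ → M} (hν : S.DecidableOver ν) : S.completion.DecidableOver (S.toCompletion ∘ ν) := by
  let := S.pseudoMetricSpace
  rw [decidableOver_iff_of_sim_eq_dist fun _ _ => rfl,
    hS.isEmbedding_toCompletion.elemDiagram S.denseRange_toCompletion hS.completion]
  exact ⟨S.denseRange_toCompletion.comp hν.1
    S.isUniformInducing_toCompletion.uniformContinuous.continuous, hν.2⟩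

end Completion

end PreStructure

end RPL

theorem theorem3p12_general {L : RPL.Signature} (T : Set (RPL.LFormula L)) {M : Type*}
    (S : RPL.PreStructure L M) (hS : S.Models (RPL.withUL T)) :
    ∃ N : RPL.PreStructure L S.Completion,
      (∀ x y, (N.sim x y : ℝ) = dist x y) ∧
      N.IsMetric ∧ N.IsComplete ∧
      N.Models (RPL.withUL T) ∧
      S.IsElementaryMap N S.toCompletion ∧
      S.ElementarilyEquivalent N ∧
      N.elemDiagram S.toCompletion = S.elemDiagram id ∧
      ∀ ν : ℕ → M, S.DecidableOver ν → N.DecidableOver (S.toCompletion ∘ ν) := by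
  have hsim (x y : S.Completion) : (S.completion.sim x y : ℝ) = dist x y := rfl
  have hUL : S.Models {φ | RPL.UL L φ} := fun φ hφ => hS φ (.inr hφ)
  have huc := hUL.isUniformlyContinuous
  have hj := huc.isEmbedding_toCompletion
  have hd := S.denseRange_toCompletion
  exact ⟨S.completion, hsim, RPL.PreStructure.isMetric_of_sim_eq_dist hsim,
    RPL.PreStructure.isComplete_of_sim_eq_dist hsim, hj.models hd huc.completion hS,
    hj.isElementaryMap hd huc.completion,
    fun φ _ => (hj.degree_lFormula hd huc.completion φ).symm,
    hj.elemDiagram hd huc.completion id, fun _ hν => hν.completion huc⟩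

theorem theorem3p12 {L : RPL.Signature} (hL : L.ComputablyGiven)
    (T : Set (RPL.LFormula L))
    (hcons : RPL.Consistent (RPL.withUL T))
    (hlin : RPL.LinearComplete (RPL.withUL T))
    (hax : RPL.ComputablyAxiomatizable (RPL.withUL T))
    (hhenkin : RPL.Henkin (RPL.withUL T))
    {M : Type*} (S : RPL.PreStructure L M) (hS : S.Models (RPL.withUL T))
    (ν : ℕ → M) (hν : Function.Surjective ν) (hdec : S.DecidableOver ν) :
    ∃ N : RPL.PreStructure L S.Completion,
      (∀ x y, (N.sim x y : ℝ) = dist x y) ∧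
      N.IsMetric ∧ N.IsComplete ∧
      N.Models (RPL.withUL T) ∧
      S.IsElementaryMap N S.toCompletion ∧
      S.ElementarilyEquivalent N ∧
      N.elemDiagram S.toCompletion = S.elemDiagram id ∧
      N.DecidableOver (S.toCompletion ∘ ν) ∧
      N.IsDecidable := by
  obtain ⟨N, hsim, hmet, hcomp, hmod, helem, hequiv, hdiag, hN⟩ := theorem3p12_general T S hS
  exact ⟨N, hsim, hmet, hcomp, hmod, helem, hequiv, hdiag, hN ν hdec, _, hN ν hdec⟩
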